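/- Let $m\ge 0$, $k\ge 1$ and $n\ge 1$ be integers with $k>m(n-1)$. Let $k_1,\dots,k_n\in\{k,k+1\}$ and put $s=|\{1\le j\le n:\ k_j=k+1\}|$. Then the rational number $$c=\Big(\prod_{j=0}^{s-1}\frac{1}{k-jm}\Big)\,\frac{\big(\sum_{j=1}^{n}k_j-mn^2+mn-n\big)!}{(m!)^n}\,\prod_{j=1}^{n}\frac{(jm)!}{(k-1-jm+m)!}$$ is an integer, and over every field $F$ the coefficient of the monomial $x_1^{k_1-1}\cdots x_n^{k_n-1}$ in the polynomial $$\prod_{1\le i\ne j\le n}(x_i-x_j)^m\,(x_1+\cdots+x_n)^{\sum_{j=1}^n(k_j-1)-mn(n-1)}\in F[x_1,\dots,x_n]$$ (the first product is over ordered pairs $(i,j)$ with $i\ne j$) equals the image of $c$ in $F$. In particular, over a field of characteristic zero, the coefficient equals $c$. -/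

import Mathlib

/-!
The coefficient is first computed over `ℚ`; since the polynomial has integer coefficients, the
value over an arbitrary field is the image of the integer found there.

Write `V = ∏_{i ≠ j} (x_i - x_j) ^ m`, and for `α : ι → ℕ` let `E_α` be the linear functional
sending the monomial `x ^ β` to `∏_j α_j (α_j - 1) ⋯ (α_j - β_j + 1)`. Expanding the power of
`x_1 + ⋯ + x_n` by the multinomial theorem shows that the coefficient of `x ^ α` in
`V (x_1 + ⋯ + x_n) ^ e` is `e! E_α(V) / ∏_j α_j!` (`coeff_mul_sum_X_pow`). So `E_α(V)` has to be
found when every `α_j` is `k - 1` or `k`.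

The functional `E_α` behaves like integration against a product of Gamma densities with shape
parameters `-α_j`. It satisfies an integration by parts formula (`fallingFunctional_X_mul`), and
for constant `α` it is symmetric in the variables, so Aomoto's argument for the Selberg integral
applies: with `α` constantly `k`, the value at `V ∏_{i ∈ S} x_i` is that at `V` times a product of
`|S|` linear factors in `k` (`fallingFunctional_prod_X`). On the other hand multiplication by `x_i`
lowers `α_i` by one, up to the factor `α_i` (`fallingFunctional_prod_X_mul`). Together these express
every `E_α(V)` with `α_j ∈ {k - 1, k}` through `E_{k-1}(V)`, and give a recursion for `E_k(V)` in
`k` (`fallingFunctional_shift`). The recursion starts at `k = m (n - 1)`, where `e = 0` and the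
coefficient is Dyson's constant term `(mn)! / m! ^ n` (`coeff_dysonProd`); the latter is proved by
Good's argument, a recursion obtained from Lagrange interpolation of the constant `1`.
-/

open MvPolynomial Finset

/-! ### Dyson's constant term identity -/

section Dyson

variable {ι R : Type*} [DecidableEq ι] [CommRing R]

omit [DecidableEq ι] in
/-- Multiplying by a power of `X l - X i` preserves the coefficients of top degree in `X l`. -/
theorem coeff_mul_X_sub_X_pow [Nontrivial R] {l i : ι} (hil : i ≠ l) (c : ℕ) {d : ℕ}
    {B : MvPolynomial ι R} (hB : B.degreeOf l ≤ d) {β : ι →₀ ℕ} (hβ : β l = 0) :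
    (B * (X l - X i) ^ c).degreeOf l ≤ d + c ∧
      coeff (Finsupp.single l (d + c) + β) (B * (X l - X i) ^ c) =
        coeff (Finsupp.single l d + β) B := by
  induction c with
  | zero => simpa using hB
  | succ c ih =>
    obtain ⟨ih₁, ih₂⟩ := ih
    have hX : (X l - X i : MvPolynomial ι R).degreeOf l ≤ 1 := by
      refine (degreeOf_sub_le _ _ _).trans ?_
      simp [degreeOf_X_of_ne hil.symm]
    refine ⟨?_, ?_⟩
    · rw [pow_succ, ← mul_assoc]
      exact (degreeOf_mul_le _ _ _).trans (by omega)
    · rw [pow_succ, ← mul_assoc, mul_sub, coeff_sub, ← ih₂]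
      have h0 : coeff (Finsupp.single l (d + (c + 1)) + β) (B * (X l - X i) ^ c * X i) = 0 := by
        rw [← notMem_support_iff]
        apply notMem_support_of_degreeOf_lt l
        rw [degreeOf_mul_X_of_ne _ hil.symm]
        simp [hβ]
        omega
      have h1 : Finsupp.single l (d + (c + 1)) + β =
          Finsupp.single l (d + c) + β + Finsupp.single l 1 := by
        rw [← add_assoc d, Finsupp.single_add]; abel
      rw [h0, sub_zero, h1, coeff_mul_X]

theorem coeff_mul_prod_X_sub_X_pow [Nontrivial R] {l : ι} (a : ι → ℕ) {T : Finset ι} (hl : l ∉ T)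
    {A : MvPolynomial ι R} (hA : A.degreeOf l = 0) {β : ι →₀ ℕ} (hβ : β l = 0) :
    (A * ∏ i ∈ T, (X l - X i) ^ a i).degreeOf l ≤ ∑ i ∈ T, a i ∧
      coeff (Finsupp.single l (∑ i ∈ T, a i) + β) (A * ∏ i ∈ T, (X l - X i) ^ a i) =
        coeff β A := by
  induction T using Finset.induction_on with
  | empty => simp [hA]
  | insert i T hi ih =>
    obtain ⟨ih₁, ih₂⟩ := ih fun h => hl (mem_insert_of_mem h)
    have hil : i ≠ l := fun h => hl (h ▸ mem_insert_self _ _)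
    have := coeff_mul_X_sub_X_pow hil (a i) ih₁ hβ
    rwa [ih₂, mul_assoc, mul_comm (∏ i ∈ T, _), ← prod_insert (f := fun i => (X l - X i) ^ a i) hi,
      add_comm, ← sum_insert hi] at this

variable (R) in
/-- Dyson's product `∏ (x_j - x_i) ^ a_i` over the ordered pairs of distinct elements of `S`,
that is, `∏ (1 - x_i / x_j) ^ a_i` with the denominators cleared. -/
noncomputable def dysonProd (S : Finset ι) (a : ι → ℕ) : MvPolynomial ι R :=
  ∏ i ∈ S, (∏ j ∈ S.erase i, (X j - X i)) ^ a i

/-- The exponent of the denominator in `∏ (1 - x_i / x_j) ^ a_i`: the coefficient of `dysonProd` at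
this exponent is the constant term of that Laurent polynomial. -/
noncomputable def dysonExponent (S : Finset ι) (a : ι → ℕ) : ι →₀ ℕ :=
  ∑ j ∈ S, Finsupp.single j (∑ i ∈ S.erase j, a i)

theorem dysonProd_insert {l : ι} {T : Finset ι} (hl : l ∉ T) {a : ι → ℕ} (ha : a l = 0) :
    dysonProd R (insert l T) a = dysonProd R T a * ∏ i ∈ T, (X l - X i) ^ a i := by
  rw [dysonProd, prod_insert hl, ha, pow_zero, one_mul, dysonProd, ← prod_mul_distrib]
  refine prod_congr rfl fun i hi => ?_
  have hil : l ≠ i := fun h => hl (h ▸ hi)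
  rw [erase_insert_of_ne hil, prod_insert (fun h => hl (mem_of_mem_erase h)), mul_pow, mul_comm]

theorem degreeOf_dysonProd [Nontrivial R] {l : ι} {T : Finset ι} (hl : l ∉ T) (a : ι → ℕ) :
    (dysonProd R T a).degreeOf l = 0 := by
  refine Nat.le_zero.1 ((degreeOf_prod_le _ _ _).trans (Nat.le_zero.2 (sum_eq_zero fun i hi => ?_)))
  refine Nat.le_zero.1 ((degreeOf_pow_le _ _ _).trans ?_)
  rw [Nat.le_zero, mul_eq_zero]
  refine Or.inr (Nat.le_zero.1 ((degreeOf_prod_le _ _ _).trans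
    (Nat.le_zero.2 (sum_eq_zero fun j hj => ?_))))
  refine Nat.le_zero.1 ((degreeOf_sub_le _ _ _).trans ?_)
  have hlj : l ≠ j := fun h => hl (h ▸ mem_of_mem_erase hj)
  have hli : l ≠ i := fun h => hl (h ▸ hi)
  rw [degreeOf_X_of_ne hlj, degreeOf_X_of_ne hli, max_self]

theorem dysonExponent_apply_of_notMem {l : ι} {T : Finset ι} (hl : l ∉ T) (a : ι → ℕ) :
    dysonExponent T a l = 0 := by
  rw [dysonExponent, Finsupp.finsetSum_apply]
  exact sum_eq_zero fun j hj => Finsupp.single_eq_of_ne (fun h => hl (h ▸ hj))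

theorem dysonExponent_insert {l : ι} {T : Finset ι} (hl : l ∉ T) {a : ι → ℕ} (ha : a l = 0) :
    dysonExponent (insert l T) a = Finsupp.single l (∑ i ∈ T, a i) + dysonExponent T a := by
  rw [dysonExponent, sum_insert hl, erase_insert hl, dysonExponent]
  congr 1
  refine sum_congr rfl fun j hj => ?_
  have hjl : l ≠ j := fun h => hl (h ▸ hj)
  rw [erase_insert_of_ne hjl, sum_insert (fun h => hl (mem_of_mem_erase h)), ha, zero_add]

theorem prod_sub_mul_dysonProd_update {l : ι} {S : Finset ι} (hl : l ∈ S) {a : ι → ℕ}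
    (ha : a l ≠ 0) :
    (∏ j ∈ S.erase l, (X j - X l)) * dysonProd R S (Function.update a l (a l - 1)) =
      dysonProd R S a := by
  obtain ⟨c, hc⟩ := Nat.exists_eq_succ_of_ne_zero ha
  rw [dysonProd, dysonProd, ← mul_prod_erase S _ hl, ← mul_prod_erase S _ hl, ← mul_assoc,
    Function.update_self, hc, Nat.succ_eq_add_one, Nat.add_sub_cancel, pow_succ' _ c]
  congr 1
  refine prod_congr rfl fun i hi => ?_
  rw [Function.update_of_ne (ne_of_mem_erase hi)]

theorem dysonExponent_update {l : ι} {S : Finset ι} (hl : l ∈ S) {a : ι → ℕ} (ha : a l ≠ 0) :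
    dysonExponent S (Function.update a l (a l - 1)) + ∑ j ∈ S.erase l, Finsupp.single j 1 =
      dysonExponent S a := by
  rw [dysonExponent, dysonExponent, ← add_sum_erase S _ hl, ← add_sum_erase S _ hl, add_assoc,
    ← sum_add_distrib]
  congr 1
  · congr 1
    exact sum_congr rfl fun i hi => by rw [Function.update_of_ne (ne_of_mem_erase hi)]
  · refine sum_congr rfl fun j hj => ?_
    have hlj : l ∈ S.erase j := mem_erase.2 ⟨(ne_of_mem_erase hj).symm, hl⟩
    rw [← Finsupp.single_add]
    congr 1
    have hu : ∑ i ∈ (S.erase j).erase l, Function.update a l (a l - 1) i =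
        ∑ i ∈ (S.erase j).erase l, a i :=
      sum_congr rfl fun i hi => by rw [Function.update_of_ne (ne_of_mem_erase hi)]
    rw [← add_sum_erase _ _ hlj, ← add_sum_erase _ a hlj, Function.update_self, hu]
    omega

/-- Lagrange interpolation of the constant `1`, evaluated at `0`. -/
theorem sum_prod_div_prod_sub {K : Type*} [Field K] {S : Finset ι} (hS : S.Nonempty) {v : ι → K}
    (hv : Set.InjOn v S) :
    ∑ l ∈ S, (∏ j ∈ S.erase l, v j) / ∏ j ∈ S.erase l, (v j - v l) = 1 := by
  have h := congrArg (Polynomial.eval 0) (Lagrange.sum_basis hv hS)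
  rw [Polynomial.eval_finsetSum, Polynomial.eval_one] at h
  rw [← h]
  refine sum_congr rfl fun l hl => ?_
  rw [Lagrange.basis, Polynomial.eval_prod, ← prod_div_distrib]
  refine prod_congr rfl fun j hj => ?_
  rw [Lagrange.basisDivisor, Polynomial.eval_mul, Polynomial.eval_C, Polynomial.eval_sub,
    Polynomial.eval_X, Polynomial.eval_C, zero_sub, ← neg_sub (v j), inv_neg, neg_mul_neg,
    div_eq_inv_mul]

/-- Good's recursion: Dyson's product, multiplied by Lagrange's expression for `1`, is a sum of the
products with one parameter lowered by one. -/
theorem dysonProd_eq_sum [IsDomain R] {S : Finset ι} (hS : S.Nonempty) {a : ι → ℕ}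
    (ha : ∀ l ∈ S, a l ≠ 0) :
    dysonProd R S a =
      ∑ l ∈ S, (∏ j ∈ S.erase l, X j) * dysonProd R S (Function.update a l (a l - 1)) := by
  let K := FractionRing (MvPolynomial ι R)
  let φ := algebraMap (MvPolynomial ι R) K
  have hφ : Function.Injective φ := IsFractionRing.injective _ _
  have hv : Set.InjOn (fun i => φ (X i)) S := fun i _ j _ h => X_injective (hφ h)
  apply hφ
  rw [map_sum, ← one_mul (φ (dysonProd R S a)), ← sum_prod_div_prod_sub hS hv, sum_mul]
  refine sum_congr rfl fun l hl => ?_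
  have h0 : ∏ j ∈ S.erase l, (φ (X j) - φ (X l)) ≠ 0 :=
    prod_ne_zero_iff.2 fun j hj => sub_ne_zero.2 fun h =>
      ne_of_mem_erase hj (X_injective (hφ h))
  rw [← prod_sub_mul_dysonProd_update hl (ha l hl), map_mul, map_mul, map_prod, map_prod]
  simp_rw [map_sub]
  rw [← mul_assoc, div_mul_cancel₀ _ h0]

theorem multinomial_eq_sum_update {S : Finset ι} (hS : S.Nonempty) {a : ι → ℕ}
    (ha : ∀ l ∈ S, a l ≠ 0) :
    Nat.multinomial S a = ∑ l ∈ S, Nat.multinomial S (Function.update a l (a l - 1)) := by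
  have hpos : 0 < ∏ i ∈ S, (a i).factorial := prod_pos fun i _ => Nat.factorial_pos _
  apply Nat.eq_of_mul_eq_mul_left hpos
  rw [Nat.multinomial_spec, mul_sum]
  obtain ⟨N, hN⟩ : ∃ N, ∑ i ∈ S, a i = N + 1 := by
    obtain ⟨l, hl⟩ := hS
    exact Nat.exists_eq_succ_of_ne_zero fun h => ha l hl (sum_eq_zero_iff.1 h l hl)
  have key : ∀ l ∈ S, (∏ i ∈ S, (a i).factorial) *
      Nat.multinomial S (Function.update a l (a l - 1)) = a l * N.factorial := by
    intro l hl
    have hs : ∑ i ∈ S, Function.update a l (a l - 1) i = N := by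
      have hu : ∑ i ∈ S.erase l, Function.update a l (a l - 1) i = ∑ i ∈ S.erase l, a i :=
        sum_congr rfl fun i hi => by rw [Function.update_of_ne (ne_of_mem_erase hi)]
      rw [← add_sum_erase _ _ hl, Function.update_self, hu]
      rw [← add_sum_erase _ _ hl] at hN
      have := ha l hl
      omega
    have hp : ∏ i ∈ S, (a i).factorial =
        a l * ∏ i ∈ S, (Function.update a l (a l - 1) i).factorial := by
      rw [← mul_prod_erase _ _ hl, ← mul_prod_erase _ _ hl, Function.update_self, ← mul_assoc,
        Nat.mul_factorial_pred (ha l hl)]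
      congr 1
      exact prod_congr rfl fun i hi => by rw [Function.update_of_ne (ne_of_mem_erase hi)]
    rw [hp, mul_assoc, Nat.multinomial_spec, hs]
  rw [sum_congr rfl key, ← sum_mul, hN, Nat.factorial_succ]

/-- Dyson's constant term identity. If all parameters are positive, Good's recursion matches that
of the multinomial coefficients; if `a l = 0`, the coefficient is of top degree in `X l`, and the
variable `X l` can be dropped. -/
theorem coeff_dysonProd [IsDomain R] (S : Finset ι) (a : ι → ℕ) :
    coeff (dysonExponent S a) (dysonProd R S a) = Nat.multinomial S a := by
  induction h : ∑ i ∈ S, a i + S.card using Nat.strong_induction_on generalizing S a with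
  | _ N ih =>
  subst h
  rcases S.eq_empty_or_nonempty with rfl | hS
  · simp [dysonExponent, dysonProd]
  by_cases ha : ∀ l ∈ S, a l ≠ 0
  · rw [dysonProd_eq_sum hS ha, coeff_sum, multinomial_eq_sum_update hS ha, Nat.cast_sum]
    refine sum_congr rfl fun l hl => ?_
    have hX : (∏ j ∈ S.erase l, X j : MvPolynomial ι R) =
        monomial (∑ j ∈ S.erase l, Finsupp.single j 1) 1 := (monomial_sum_one _ _).symm
    rw [← dysonExponent_update hl (ha l hl), hX, add_comm, coeff_monomial_mul, one_mul]
    refine ih _ (Nat.add_lt_add_right (sum_lt_sum (fun i _ => ?_) ⟨l, hl, ?_⟩) _) _ _ rfl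
    · by_cases hi : i = l
      · subst hi; simp
      · simp [Function.update_of_ne hi]
    · have := ha l hl
      rw [Function.update_self]; omega
  · push Not at ha
    obtain ⟨l, hl, hal⟩ := ha
    obtain ⟨T, hlT, rfl⟩ : ∃ T, l ∉ T ∧ insert l T = S :=
      ⟨S.erase l, notMem_erase _ _, insert_erase hl⟩
    rw [dysonExponent_insert hlT hal, dysonProd_insert hlT hal,
      (coeff_mul_prod_X_sub_X_pow a hlT (degreeOf_dysonProd hlT a)
        (dysonExponent_apply_of_notMem hlT a)).2, ih _ ?_ T a rfl]
    · rw [Nat.multinomial_insert hlT, hal]; simp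
    · rw [sum_insert hlT, card_insert_of_notMem hlT]; omega

end Dyson

/-! ### The falling factorial functional -/

section Functional

variable {ι : Type*} [DecidableEq ι] [Fintype ι]

/-- The linear functional sending `x ^ β` to the product of the falling factorials of the `α j` of
lengths `β j`. Up to sign this is the moment functional of independent Gamma variables with
(negative) shape parameters `-α j`. -/
noncomputable def fallingFunctional (α : ι → ℕ) : MvPolynomial ι ℚ →ₗ[ℚ] ℚ :=
  (basisMonomials ι ℚ).constr ℚ fun β => ∏ j, ((α j).descFactorial (β j) : ℚ)

omit [DecidableEq ι] in
theorem fallingFunctional_monomial (α : ι → ℕ) (β : ι →₀ ℕ) (c : ℚ) :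
    fallingFunctional α (monomial β c) = c * ∏ j, ((α j).descFactorial (β j) : ℚ) := by
  have h : (monomial β c : MvPolynomial ι ℚ) = c • basisMonomials ι ℚ β := by
    simp [smul_monomial]
  rw [h, map_smul, fallingFunctional, Module.Basis.constr_basis, smul_eq_mul]

theorem cast_descFactorial_succ (k b : ℕ) :
    (k.descFactorial (b + 1) : ℚ) = (k - b) * k.descFactorial b := by
  rw [Nat.descFactorial_succ, Nat.cast_mul]
  rcases le_or_gt b k with h | h
  · rw [Nat.cast_sub h]
  · simp [Nat.descFactorial_of_lt h]

/-- Integration by parts. -/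
theorem fallingFunctional_X_mul (α : ι → ℕ) (l : ι) (f : MvPolynomial ι ℚ) :
    fallingFunctional α (X l * f) =
      α l * fallingFunctional α f - fallingFunctional α (X l * pderiv l f) := by
  induction f using MvPolynomial.induction_on' with
  | add p q hp hq => simp only [mul_add, map_add, hp, hq]; ring
  | monomial β c =>
    rw [X_mul_pderiv_monomial, X, monomial_mul, one_mul, map_nsmul, fallingFunctional_monomial,
      fallingFunctional_monomial, ← mul_prod_erase univ _ (mem_univ l),
      ← mul_prod_erase univ _ (mem_univ l)]
    have h : ∏ j ∈ univ.erase l, ((α j).descFactorial ((Finsupp.single l 1 + β : ι →₀ ℕ) j) : ℚ) =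
        ∏ j ∈ univ.erase l, ((α j).descFactorial (β j) : ℚ) :=
      prod_congr rfl fun j hj => by simp [Finsupp.single_eq_of_ne (ne_of_mem_erase hj)]
    rw [h, Finsupp.add_apply, Finsupp.single_eq_same, add_comm 1, cast_descFactorial_succ]
    simp only [nsmul_eq_mul]
    ring

omit [DecidableEq ι] in
theorem fallingFunctional_rename (k : ℕ) (σ : Equiv.Perm ι) (f : MvPolynomial ι ℚ) :
    fallingFunctional (fun _ => k) (rename σ f) = fallingFunctional (fun _ => k) f := by
  induction f using MvPolynomial.induction_on' with
  | add p q hp hq => simp only [map_add, hp, hq]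
  | monomial β c =>
    rw [rename_monomial, fallingFunctional_monomial, fallingFunctional_monomial]
    congr 1
    rw [← Equiv.prod_comp σ]
    simp [Finsupp.mapDomain_apply σ.injective]

/-- Multiplication by the variables in `T` lowers the parameters in `T` by one. -/
theorem fallingFunctional_prod_X_mul {k : ℕ} (hk : 0 < k) {T : Finset ι} {α : ι → ℕ}
    (hα : ∀ j, α j = if j ∈ T then k - 1 else k) (f : MvPolynomial ι ℚ) :
    fallingFunctional (fun _ => k) ((∏ j ∈ T, X j) * f) =
      (k : ℚ) ^ T.card * fallingFunctional α f := by
  induction f using MvPolynomial.induction_on' with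
  | add p q hp hq => simp only [map_add, mul_add, hp, hq]
  | monomial β c =>
    have hX : (∏ j ∈ T, X j : MvPolynomial ι ℚ) =
        monomial (∑ j ∈ T, Finsupp.single j 1) 1 := (monomial_sum_one _ _).symm
    have hT : (k : ℚ) ^ T.card = ∏ j, if j ∈ T then (k : ℚ) else 1 := by
      simp [prod_ite_mem]
    rw [hX, monomial_mul, one_mul, fallingFunctional_monomial, fallingFunctional_monomial, hT,
      mul_left_comm, ← prod_mul_distrib]
    congr 1
    refine prod_congr rfl fun j _ => ?_
    have hj : (∑ i ∈ T, Finsupp.single i 1 : ι →₀ ℕ) j = if j ∈ T then 1 else 0 := by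
      simp [Finsupp.finsetSum_apply, Finsupp.single_apply]
    rw [Finsupp.add_apply, hj, hα]
    obtain ⟨k, rfl⟩ := Nat.exists_eq_succ_of_ne_zero hk.ne'
    split_ifs
    · rw [add_comm 1, Nat.succ_descFactorial_succ]; simp
    · simp

omit [DecidableEq ι] in
theorem coeff_monomial_mul_sum_X_pow {α β : ι →₀ ℕ} {e : ℕ} (c : ℚ)
    (h : ∑ j, β j + e = ∑ j, α j) :
    coeff α (monomial β c * (∑ j, X j) ^ e) * ∏ j, ((α j).factorial : ℚ) =
      e.factorial * fallingFunctional α (monomial β c) := by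
  rw [coeff_monomial_mul', fallingFunctional_monomial]
  split_ifs with hle
  · have hsub : ∀ j, (α - β) j = α j - β j := fun j => rfl
    have hle' : ∀ j, β j ≤ α j := hle
    have hs : ∑ j, (α - β) j = e := by
      simp only [hsub]
      rw [sum_tsub_distrib _ fun j _ => hle' j]; omega
    rw [coeff_sum_X_pow_of_fintype, if_pos (by rw [Finsupp.sum_fintype _ _ fun _ => rfl, hs]),
      Finsupp.multinomial_eq_of_support_subset (subset_univ _)]
    have hm := Nat.multinomial_spec univ (α - β : ι →₀ ℕ)
    rw [hs] at hm
    rw [← hm]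
    have hd : ∀ j, ((α j).factorial : ℚ) =
        ((α - β) j).factorial * (α j).descFactorial (β j) := fun j => by
      rw [hsub]; exact_mod_cast (Nat.factorial_mul_descFactorial (hle' j)).symm
    simp_rw [hd]
    rw [prod_mul_distrib]
    push_cast
    ring
  · obtain ⟨j, hj⟩ : ∃ j, α j < β j := by
      by_contra! hc; exact hle hc
    have h0 : ∏ j, ((α j).descFactorial (β j) : ℚ) = 0 :=
      prod_eq_zero (mem_univ j) (by rw [Nat.descFactorial_of_lt hj, Nat.cast_zero])
    rw [h0]
    simp

omit [DecidableEq ι] in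
/-- The multinomial theorem turns coefficients of `f * (∑ j, X j) ^ e` into values of the falling
factorial functional. -/
theorem coeff_mul_sum_X_pow {f : MvPolynomial ι ℚ} {d e : ℕ} (hf : f.IsHomogeneous d)
    {α : ι →₀ ℕ} (h : d + e = ∑ j, α j) :
    coeff α (f * (∑ j, X j) ^ e) * ∏ j, ((α j).factorial : ℚ) =
      e.factorial * fallingFunctional α f := by
  rw [f.as_sum, sum_mul, coeff_sum, sum_mul, map_sum, mul_sum]
  refine sum_congr rfl fun β hβ => coeff_monomial_mul_sum_X_pow _ ?_
  rw [← h, ← hf (mem_support_iff.1 hβ), Finsupp.weight_apply, Finsupp.sum_fintype _ _ (by simp)]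
  simp

end Functional

/-! ### Aomoto's argument -/

section Aomoto

variable {ι : Type*} [DecidableEq ι] [Fintype ι]

variable (ι) in
/-- The product of `(x_i - x_j) ^ m` over all ordered pairs of distinct indices. -/
noncomputable def diffProd (R : Type*) [CommRing R] (m : ℕ) : MvPolynomial ι R :=
  ∏ p ∈ (univ : Finset ι).offDiag, (X p.1 - X p.2) ^ m

/-- For `m ≠ 0` and `p.1 ≠ p.2`, the product `diffProd` with one factor `X p.1 - X p.2` removed. -/
noncomputable def diffQuot (m : ℕ) (p : ι × ι) : MvPolynomial ι ℚ :=
  (X p.1 - X p.2) ^ (m - 1) * ∏ q ∈ (univ : Finset ι).offDiag.erase p, (X q.1 - X q.2) ^ m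

theorem sub_mul_diffQuot {m : ℕ} (hm : m ≠ 0) {i j : ι} (hij : i ≠ j) :
    (X i - X j) * diffQuot m (i, j) = diffProd ι ℚ m := by
  have hp : (i, j) ∈ (univ : Finset ι).offDiag := by simp [hij]
  rw [diffQuot, diffProd, ← mul_prod_erase _ _ hp, ← mul_assoc, mul_pow_sub_one hm]

omit [DecidableEq ι] [Fintype ι] in
theorem X_sub_X_ne_zero {i j : ι} (hij : i ≠ j) : (X i - X j : MvPolynomial ι ℚ) ≠ 0 :=
  sub_ne_zero.2 fun h => hij (X_injective h)

theorem diffQuot_swap {m : ℕ} (hm : m ≠ 0) {i j : ι} (hij : i ≠ j) :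
    diffQuot m (j, i) = -diffQuot m (i, j) := by
  apply mul_left_cancel₀ (X_sub_X_ne_zero hij.symm)
  rw [sub_mul_diffQuot hm hij.symm, ← sub_mul_diffQuot hm hij]
  ring

omit [DecidableEq ι] in
theorem rename_diffProd (m : ℕ) (σ : Equiv.Perm ι) :
    rename σ (diffProd ι ℚ m) = diffProd ι ℚ m := by
  rw [diffProd, map_prod]
  refine prod_bij (fun p _ => (σ p.1, σ p.2)) ?_ ?_ ?_ ?_
  · simp
  · rintro ⟨a, b⟩ _ ⟨c, d⟩ _ h; simpa using h
  · rintro ⟨a, b⟩ h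
    refine ⟨(σ.symm a, σ.symm b), by simpa using h, by simp⟩
  · simp

theorem rename_swap_diffQuot {m : ℕ} (hm : m ≠ 0) {i j : ι} (hij : i ≠ j) :
    rename (Equiv.swap i j) (diffQuot m (i, j)) = -diffQuot m (i, j) := by
  have h := congrArg (rename (Equiv.swap i j)) (sub_mul_diffQuot hm hij)
  rw [rename_diffProd, map_mul, map_sub, rename_X, rename_X, Equiv.swap_apply_left,
    Equiv.swap_apply_right] at h
  apply mul_left_cancel₀ (X_sub_X_ne_zero hij.symm)
  rw [h, ← sub_mul_diffQuot hm hij]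
  ring

omit [DecidableEq ι] [Fintype ι] in
theorem pderiv_prod_pow {κ : Type*} [DecidableEq κ] (l : ι) (s : Finset κ)
    (f : κ → MvPolynomial ι ℚ) (m : ℕ) :
    pderiv l (∏ p ∈ s, f p ^ m) =
      ∑ p ∈ s, m • (f p ^ (m - 1) * (∏ q ∈ s.erase p, f q ^ m) * pderiv l (f p)) := by
  induction s using Finset.induction_on with
  | empty => simp
  | insert a s ha ih =>
    rw [prod_insert ha, pderiv_mul, ih, sum_insert ha, erase_insert ha, pderiv_pow, mul_sum]
    congr 1
    · rw [nsmul_eq_mul]; ring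
    · refine sum_congr rfl fun p hp => ?_
      have hap : a ≠ p := fun h => ha (h ▸ hp)
      rw [erase_insert_of_ne hap, prod_insert fun h => ha (mem_of_mem_erase h)]
      simp only [nsmul_eq_mul]
      ring

theorem pderiv_diffProd {m : ℕ} (hm : m ≠ 0) (l : ι) :
    pderiv l (diffProd ι ℚ m) = ∑ j ∈ univ.erase l, (2 * m) • diffQuot m (l, j) := by
  have hval : ∀ p : ι × ι, pderiv l (X p.1 - X p.2 : MvPolynomial ι ℚ) =
      (if p.1 = l then 1 else 0) - if p.2 = l then 1 else 0 := fun p => by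
    rw [map_sub, pderiv_X, pderiv_X, Pi.single_apply, Pi.single_apply]
  have h : ∀ p ∈ (univ : Finset ι).offDiag,
      m • ((X p.1 - X p.2) ^ (m - 1) *
        (∏ q ∈ (univ : Finset ι).offDiag.erase p, (X q.1 - X q.2) ^ m) *
          pderiv l (X p.1 - X p.2 : MvPolynomial ι ℚ)) =
      (if p.1 = l then m • diffQuot m (l, p.2) else 0) +
        if p.2 = l then m • diffQuot m (l, p.1) else 0 := by
    rintro ⟨a, b⟩ hp
    have hab : a ≠ b := by simpa using hp
    rw [hval]
    simp only
    rw [← diffQuot.eq_def m (a, b)]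
    split_ifs with h1 h2 h2
    · exact absurd (h1.trans h2.symm) hab
    · subst h1; simp
    · subst h2; rw [diffQuot_swap hm hab]; simp
    · simp
  rw [diffProd, pderiv_prod_pow, sum_congr rfl h, sum_add_distrib]
  have e1 : ∀ g : ι → MvPolynomial ι ℚ, ∑ p ∈ (univ : Finset ι).offDiag,
      (if p.1 = l then g p.2 else 0) = ∑ j ∈ univ.erase l, g j := fun g => by
    rw [← sum_filter]
    refine sum_bij (fun p _ => p.2) ?_ ?_ ?_ ?_
    · rintro ⟨a, b⟩ h; simp at h ⊢; grind
    · rintro ⟨a, b⟩ h ⟨c, d⟩ h' h''; simp at *; grind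
    · intro b hb; exact ⟨(l, b), by simpa [eq_comm] using hb, rfl⟩
    · simp
  have e2 : ∀ g : ι → MvPolynomial ι ℚ, ∑ p ∈ (univ : Finset ι).offDiag,
      (if p.2 = l then g p.1 else 0) = ∑ j ∈ univ.erase l, g j := fun g => by
    rw [← sum_filter]
    refine sum_bij (fun p _ => p.1) ?_ ?_ ?_ ?_
    · rintro ⟨a, b⟩ h; simp at h ⊢; grind
    · rintro ⟨a, b⟩ h ⟨c, d⟩ h' h''; simp at *; grind
    · intro b hb; exact ⟨(b, l), by simpa [eq_comm] using hb, rfl⟩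
    · simp
  rw [e1 fun j => m • diffQuot m (l, j), e2 fun j => m • diffQuot m (l, j), ← sum_add_distrib]
  refine sum_congr rfl fun j _ => ?_
  rw [← add_smul, two_mul]

/-- The terms of the derivative in Aomoto's argument, evaluated by exchanging `X l` and `X j`, which
changes the sign of `diffQuot`: the term vanishes if `X j` is a factor of the monomial; otherwise
twice the term is the difference of the two exchanged terms. -/
theorem fallingFunctional_pair {m : ℕ} (hm : m ≠ 0) (k : ℕ) {S : Finset ι} {l j : ι} (hl : l ∉ S)
    (hlj : l ≠ j) :
    fallingFunctional (fun _ => k) (X l * ((∏ i ∈ S, X i) * ((2 : ℕ) • diffQuot m (l, j)))) =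
      if j ∈ S then 0 else fallingFunctional (fun _ => k) ((∏ i ∈ S, X i) * diffProd ι ℚ m) := by
  set σ := Equiv.swap l j
  split_ifs with hj
  · have hsym : rename σ (X l * ((∏ i ∈ S, X i) * diffQuot m (l, j))) =
        -(X l * ((∏ i ∈ S, X i) * diffQuot m (l, j))) := by
      rw [← mul_assoc, ← prod_insert hl, map_mul, rename_swap_diffQuot hm hlj, map_prod]
      simp only [rename_X]
      rw [Equiv.Perm.prod_comp σ (insert l S) (fun i => (X i : MvPolynomial ι ℚ)), mul_neg]
      intro i hi
      have := Equiv.swap_apply_ne_self_iff.1 hi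
      rcases this.2 with rfl | rfl <;> simp [hj]
    have := fallingFunctional_rename k σ (X l * ((∏ i ∈ S, X i) * diffQuot m (l, j)))
    rw [hsym, map_neg] at this
    rw [mul_smul_comm, mul_smul_comm, map_nsmul]
    have h0 : fallingFunctional (fun _ => k) (X l * ((∏ i ∈ S, X i) * diffQuot m (l, j))) = 0 := by
      linarith
    rw [h0, smul_zero]
  · have hfix : ∏ i ∈ S, (X (σ i) : MvPolynomial ι ℚ) = ∏ i ∈ S, X i :=
      prod_congr rfl fun i hi => by
        rw [Equiv.swap_apply_of_ne_of_ne (ne_of_mem_of_not_mem hi hl) (ne_of_mem_of_not_mem hi hj)]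
    have hsym : rename σ (X l * ((∏ i ∈ S, X i) * diffQuot m (l, j))) =
        -(X j * ((∏ i ∈ S, X i) * diffQuot m (l, j))) := by
      rw [map_mul, map_mul, rename_swap_diffQuot hm hlj, map_prod]
      simp only [rename_X]
      rw [hfix, Equiv.swap_apply_left]
      ring
    have := fallingFunctional_rename k σ (X l * ((∏ i ∈ S, X i) * diffQuot m (l, j)))
    rw [hsym, map_neg] at this
    rw [← sub_mul_diffQuot hm hlj, show (∏ i ∈ S, X i) * ((X l - X j) * diffQuot m (l, j)) =
      X l * ((∏ i ∈ S, X i) * diffQuot m (l, j)) - X j * ((∏ i ∈ S, X i) * diffQuot m (l, j)) by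
        ring, map_sub, mul_smul_comm, mul_smul_comm, map_nsmul, two_smul]
    linarith

omit [Fintype ι] in
theorem pderiv_prod_X_of_notMem {S : Finset ι} {l : ι} (hl : l ∉ S) :
    pderiv l (∏ i ∈ S, X i : MvPolynomial ι ℚ) = 0 := by
  induction S using Finset.induction_on with
  | empty => simp
  | insert a S ha ih =>
    rw [prod_insert ha, pderiv_mul, ih fun h => hl (mem_insert_of_mem h),
      pderiv_X_of_ne (ne_of_mem_of_not_mem (mem_insert_self _ _) hl)]
    simp

/-- Aomoto's recursion for inserting one variable. -/
theorem fallingFunctional_prod_X_insert (m k : ℕ) {S : Finset ι} {l : ι} (hl : l ∉ S) :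
    fallingFunctional (fun _ => k) ((∏ i ∈ insert l S, X i) * diffProd ι ℚ m) =
      (k - m * (Fintype.card ι - 1 - S.card)) *
        fallingFunctional (fun _ => k) ((∏ i ∈ S, X i) * diffProd ι ℚ m) := by
  rw [prod_insert hl, mul_assoc, fallingFunctional_X_mul, pderiv_mul, pderiv_prod_X_of_notMem hl,
    zero_mul, zero_add]
  -- For `m = 0` the polynomial `diffQuot` is not a quotient of `diffProd`.
  rcases eq_or_ne m 0 with rfl | hm
  · simp [diffProd]
  have hc : ((((univ.erase l).filter (· ∉ S)).card : ℕ) : ℚ) =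
      Fintype.card ι - 1 - S.card := by
    have h1 : (univ.erase l).filter (· ∉ S) = univ \ insert l S := by ext; simp [and_comm]
    rw [h1, card_sdiff_of_subset (subset_univ _), Nat.cast_sub (card_le_card (subset_univ _)),
      card_insert_of_notMem hl, card_univ]
    push_cast; ring
  rw [pderiv_diffProd hm, mul_sum, mul_sum, map_sum, sum_congr rfl fun j hj =>
    show fallingFunctional (fun _ => k) (X l * ((∏ i ∈ S, X i) * ((2 * m) • diffQuot m (l, j)))) =
      if j ∉ S then m * fallingFunctional (fun _ => k) ((∏ i ∈ S, X i) * diffProd ι ℚ m) else 0 by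
    rw [mul_comm 2 m, mul_smul, mul_smul_comm, mul_smul_comm, map_nsmul,
      fallingFunctional_pair hm k hl (ne_of_mem_erase hj).symm, nsmul_eq_mul]
    split_ifs <;> simp]
  rw [← sum_filter, sum_const, nsmul_eq_mul, hc]
  ring

theorem fallingFunctional_prod_X (m k : ℕ) (S : Finset ι) :
    fallingFunctional (fun _ => k) ((∏ i ∈ S, X i) * diffProd ι ℚ m) =
      (∏ j ∈ range S.card, ((k : ℚ) - m * (Fintype.card ι - 1 - j))) *
        fallingFunctional (fun _ => k) (diffProd ι ℚ m) := by
  induction S using Finset.induction_on with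
  | empty => simp
  | insert l S hl ih =>
    rw [fallingFunctional_prod_X_insert m k hl, ih, card_insert_of_notMem hl, prod_range_succ]
    ring

end Aomoto

/-! ### Evaluation of the coefficient -/

section Evaluation

variable {ι : Type*} [DecidableEq ι] [Fintype ι]

omit [DecidableEq ι] in
theorem isHomogeneous_diffProd (m : ℕ) :
    (diffProd ι ℚ m).IsHomogeneous (m * Fintype.card ι * (Fintype.card ι - 1)) := by
  have h := IsHomogeneous.prod (univ : Finset ι).offDiag
    (fun p => (X p.1 - X p.2 : MvPolynomial ι ℚ) ^ m) (fun _ => 1 * m) fun p _ =>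
      ((isHomogeneous_X ℚ p.1).sub (isHomogeneous_X ℚ p.2)).pow m
  rw [sum_const, offDiag_card, card_univ, smul_eq_mul, one_mul] at h
  have hdeg : m * Fintype.card ι * (Fintype.card ι - 1) =
      (Fintype.card ι * Fintype.card ι - Fintype.card ι) * m := by
    rw [← Nat.mul_sub_one]; ring
  rw [hdeg]
  exact h

theorem diffProd_eq_dysonProd (m : ℕ) : diffProd ι ℚ m = dysonProd ℚ univ fun _ => m := by
  have h : (univ : Finset ι).offDiag = (univ ×ˢ univ).filter fun p : ι × ι => p.1 ≠ p.2 := by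
    ext; simp
  rw [diffProd, h, prod_filter, prod_product_right, dysonProd]
  refine prod_congr rfl fun i _ => ?_
  rw [← prod_filter, ← prod_pow]
  congr 1
  ext; simp

theorem coeff_diffProd (m : ℕ) (α : ι →₀ ℕ) (hα : ∀ j, α j = m * (Fintype.card ι - 1)) :
    coeff α (diffProd ι ℚ m) =
      ((m * Fintype.card ι).factorial : ℚ) / (m.factorial : ℚ) ^ Fintype.card ι := by
  have hd : α = dysonExponent univ fun _ => m := by
    ext j
    rw [hα, dysonExponent, Finsupp.finsetSum_apply]
    simp [Finsupp.single_apply, card_erase_of_mem, mul_comm]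
  have hm := Nat.multinomial_spec (univ : Finset ι) fun _ => m
  simp only [prod_const, sum_const, card_univ, smul_eq_mul] at hm
  rw [hd, diffProd_eq_dysonProd, coeff_dysonProd, eq_div_iff (by positivity), mul_comm m, ← hm]
  push_cast
  ring

theorem prod_range_sub_mul (k m : ℚ) (r s : ℕ) :
    (∏ j ∈ range r, (k - m * (((r + s : ℕ) : ℚ) - 1 - j))) * ∏ j ∈ range s, (k - j * m) =
      ∏ j ∈ range (r + s), (k - j * m) := by
  rw [← prod_range_reflect (fun j : ℕ => k - j * m) (r + s), prod_range_add,
    ← prod_range_reflect (fun j : ℕ => k - j * m) s]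
  congr 1
  · refine prod_congr rfl fun j hj => ?_
    have := mem_range.1 hj
    rw [Nat.sub_sub, Nat.cast_sub (by omega)]
    push_cast; ring
  · refine prod_congr rfl fun j hj => ?_
    have := mem_range.1 hj
    rw [show r + s - 1 - (r + j) = s - 1 - j by omega]

/-- Comparing, for the constant parameter `N + 1`, the two evaluations at `∏ i ∈ T, X i` and at the
product of all variables. The case `T = ∅` is the recursion in `N`. -/
theorem fallingFunctional_shift (m N : ℕ) {T : Finset ι}
    {α : ι → ℕ} (hα : ∀ j, α j = if j ∈ T then N else N + 1) :
    fallingFunctional α (diffProd ι ℚ m) * ∏ j ∈ range Tᶜ.card, (((N + 1 : ℕ) : ℚ) - j * m) =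
      ((N + 1 : ℕ) : ℚ) ^ Tᶜ.card * fallingFunctional (fun _ => N) (diffProd ι ℚ m) := by
  -- The unknown value for the parameter `N + 1` occurs in both evaluations and is eliminated.
  have hT := fallingFunctional_prod_X_mul (k := N + 1) N.succ_pos hα (diffProd ι ℚ m)
  have hU := fallingFunctional_prod_X_mul (k := N + 1) N.succ_pos (T := univ) (α := fun _ => N)
    (fun j => by simp) (diffProd ι ℚ m)
  rw [fallingFunctional_prod_X] at hT hU
  have hcard : T.card + Tᶜ.card = Fintype.card ι := card_add_card_compl T
  have h1 := prod_range_sub_mul ((N + 1 : ℕ) : ℚ) m T.card Tᶜ.card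
  have h2 := prod_range_sub_mul ((N + 1 : ℕ) : ℚ) m (Fintype.card ι) 0
  rw [hcard] at h1
  simp only [add_zero, range_zero, prod_empty, mul_one] at h2
  rw [card_univ, h2, ← h1] at hU
  rw [← hcard, pow_add] at hU
  have hk : ((N + 1 : ℕ) : ℚ) ^ T.card ≠ 0 := by positivity
  apply mul_left_cancel₀ hk
  rw [← mul_assoc, ← hT, ← mul_assoc, ← hU, hcard]
  ring

theorem mul_le_of_mul_pred_le {m n N j : ℕ} (hN : m * (n - 1) ≤ N) (hj : j < n) : j * m ≤ N := by
  rw [mul_comm]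
  exact (Nat.mul_le_mul_left m (Nat.le_sub_one_of_lt hj)).trans hN

theorem cast_sub_mul_pos {m n N j : ℕ} (hN : m * (n - 1) ≤ N) (hj : j < n) :
    (0 : ℚ) < ((N + 1 : ℕ) : ℚ) - j * m := by
  have h := mul_le_of_mul_pred_le hN hj
  have : ((j * m : ℕ) : ℚ) ≤ N := by exact_mod_cast h
  push_cast at *
  linarith

/-- Induction on `N`, starting from Dyson's identity at `N = m * (Fintype.card ι - 1)`. -/
theorem fallingFunctional_diffProd {m N : ℕ} (hι : 0 < Fintype.card ι)
    (hN : m * (Fintype.card ι - 1) ≤ N) :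
    fallingFunctional (fun _ => N) (diffProd ι ℚ m) =
      (N.factorial : ℚ) ^ Fintype.card ι / (m.factorial : ℚ) ^ Fintype.card ι *
        ∏ j ∈ range (Fintype.card ι),
          (((j + 1) * m).factorial : ℚ) / ((N - j * m).factorial : ℚ) := by
  set n := Fintype.card ι with hn
  induction N, hN using Nat.le_induction with
  | base =>
    set α : ι →₀ ℕ := Finsupp.equivFunOnFinite.symm fun _ => m * (n - 1) with hα
    have hαj : ∀ j, α j = m * (n - 1) := fun j => rfl
    have h := coeff_mul_sum_X_pow (isHomogeneous_diffProd (ι := ι) m) (α := α) (e := 0)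
      (by simp only [hαj, sum_const, card_univ, smul_eq_mul, ← hn]; ring)
    have hα' : (⇑α) = fun _ => m * (n - 1) := rfl
    rw [pow_zero, mul_one, coeff_diffProd m α hαj, hα', ← hn] at h
    simp only [prod_const, card_univ, Nat.factorial_zero, Nat.cast_one, one_mul, ← hn] at h
    rw [← h]
    -- Here the denominators, read backwards, are the numerators shifted by one, so the product
    -- telescopes to its last numerator `(m * n)!`.
    obtain ⟨c, hc⟩ := Nat.exists_eq_succ_of_ne_zero hι.ne'
    have hden : ∏ j ∈ range n, ((m * (n - 1) - j * m).factorial : ℚ) =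
        ∏ j ∈ range c, (((j + 1) * m).factorial : ℚ) := by
      rw [← prod_range_reflect, hc, prod_range_succ']
      simp only [Nat.succ_eq_add_one, Nat.add_sub_cancel]
      rw [show m * c - (c - 0) * m = 0 by rw [Nat.sub_zero, mul_comm, Nat.sub_self],
        Nat.factorial_zero, Nat.cast_one, mul_one]
      refine prod_congr rfl fun j hj => ?_
      have := mem_range.1 hj
      rw [mul_comm m, ← Nat.sub_mul, show c - (c - (j + 1)) = j + 1 by omega]
    rw [prod_div_distrib, hden, hc, Nat.succ_eq_add_one, prod_range_succ]
    have h0 : ∏ j ∈ range c, (((j + 1) * m).factorial : ℚ) ≠ 0 :=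
      prod_ne_zero_iff.2 fun j _ => by positivity
    rw [mul_comm m]
    field_simp
  | succ N hN ih =>
    have h := fallingFunctional_shift (ι := ι) m N (T := ∅) (α := fun _ => N + 1) (fun j => by simp)
    rw [compl_empty, card_univ, ih, ← hn] at h
    have h0 : ∏ j ∈ range n, (((N + 1 : ℕ) : ℚ) - j * m) ≠ 0 :=
      prod_ne_zero_iff.2 fun j hj => (cast_sub_mul_pos hN (mem_range.1 hj)).ne'
    apply mul_right_cancel₀ h0
    rw [h, Nat.factorial_succ, Nat.cast_mul, mul_pow, mul_assoc, ← prod_mul_distrib]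
    have hfac : ∀ j ∈ range n, (((j + 1) * m).factorial : ℚ) / ((N + 1 - j * m).factorial : ℚ) *
        (((N + 1 : ℕ) : ℚ) - j * m) =
          (((j + 1) * m).factorial : ℚ) / ((N - j * m).factorial : ℚ) := by
      intro j hj
      have hj' : j * m ≤ N := mul_le_of_mul_pred_le hN (mem_range.1 hj)
      have hpos := cast_sub_mul_pos hN (mem_range.1 hj)
      rw [Nat.succ_sub hj', Nat.factorial_succ, Nat.cast_mul, Nat.cast_succ (N - j * m),
        Nat.cast_sub hj']
      push_cast at hpos ⊢
      have h2 : (N : ℚ) - j * m + 1 ≠ 0 := by linarith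
      field_simp
      ring
    rw [prod_congr rfl hfac]
    ring

theorem coeff_diffProd_mul_sum_X_pow {m N e : ℕ} (hι : 0 < Fintype.card ι)
    (hN : m * (Fintype.card ι - 1) ≤ N) {T : Finset ι} {α : ι →₀ ℕ}
    (hα : ∀ j, α j = if j ∈ T then N else N + 1)
    (he : m * Fintype.card ι * (Fintype.card ι - 1) + e = ∑ j, α j) :
    coeff α (diffProd ι ℚ m * (∑ j, X j) ^ e) =
      (∏ j ∈ range Tᶜ.card, 1 / (((N + 1 : ℕ) : ℚ) - j * m)) *
        ((e.factorial : ℚ) / (m.factorial : ℚ) ^ Fintype.card ι) *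
        ∏ j ∈ range (Fintype.card ι),
          (((j + 1) * m).factorial : ℚ) / ((N - j * m).factorial : ℚ) := by
  have h := coeff_mul_sum_X_pow (isHomogeneous_diffProd (ι := ι) m) he
  have hs := fallingFunctional_shift m N hα
  rw [fallingFunctional_diffProd hι hN] at hs
  have hfac : ∏ j, ((α j).factorial : ℚ) =
      (N.factorial : ℚ) ^ Fintype.card ι * ((N + 1 : ℕ) : ℚ) ^ Tᶜ.card := by
    have : ∀ j, ((α j).factorial : ℚ) =
        N.factorial * if j ∈ Tᶜ then ((N + 1 : ℕ) : ℚ) else 1 := fun j => by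
      rw [hα]
      by_cases hj : j ∈ T
      · simp [hj]
      · simp [hj, Nat.factorial_succ, mul_comm]
    rw [prod_congr rfl fun j _ => this j, prod_mul_distrib, prod_const, card_univ,
      prod_ite_mem, univ_inter, prod_const]
  have h0 : ∏ j ∈ range Tᶜ.card, (((N + 1 : ℕ) : ℚ) - j * m) ≠ 0 :=
    prod_ne_zero_iff.2 fun j hj =>
      (cast_sub_mul_pos hN ((mem_range.1 hj).trans_le (card_le_univ _))).ne'
  have h1 : (N.factorial : ℚ) ^ Fintype.card ι * ((N + 1 : ℕ) : ℚ) ^ Tᶜ.card ≠ 0 := by positivity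
  rw [hfac] at h
  rw [prod_div_distrib, prod_const_one]
  apply mul_right_cancel₀ h1
  apply mul_right_cancel₀ h0
  rw [h, mul_assoc, hs]
  set D := ∏ j ∈ range Tᶜ.card, (((N + 1 : ℕ) : ℚ) - j * m)
  field_simp

omit [DecidableEq ι] in
theorem map_diffProd_mul_sum_X_pow {R : Type*} [CommRing R] (m e : ℕ) :
    map (Int.castRingHom R) (diffProd ι ℤ m * (∑ j, X j) ^ e) =
      diffProd ι R m * (∑ j, X j) ^ e := by
  simp [diffProd, map_prod, map_sum]

end Evaluation

theorem proposition2p1 {F : Type*} [Field F] (m k n : ℕ) (hk : 0 < k) (hn : 0 < n)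
    (κ : Fin n → ℕ) (hκ : ∀ j, κ j = k ∨ κ j = k + 1) (hkm : m * (n - 1) < k)
    (s : ℕ) (hs : s = (Finset.univ.filter fun j : Fin n => κ j = k + 1).card) :
    ∃ c : ℤ,
      (c : ℚ) = (∏ j ∈ Finset.range s, 1 / ((k : ℚ) - (j : ℚ) * (m : ℚ))) *
        ((((∑ j, κ j) + m * n - (m * n ^ 2 + n)).factorial : ℚ) / (m.factorial : ℚ) ^ n) *
        ∏ j ∈ Finset.Icc 1 n,
          ((j * m).factorial : ℚ) / ((k - 1 + m - j * m).factorial : ℚ) ∧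
      MvPolynomial.coeff (Finsupp.equivFunOnFinite.symm fun j => κ j - 1)
        ((∏ p ∈ (Finset.univ : Finset (Fin n)).offDiag,
            (MvPolynomial.X p.1 - MvPolynomial.X p.2 : MvPolynomial (Fin n) F) ^ m) *
          (∑ j, (MvPolynomial.X j : MvPolynomial (Fin n) F)) ^
            ((∑ j, (κ j - 1)) - m * n * (n - 1))) = (c : F) := by
  obtain ⟨N, rfl⟩ := Nat.exists_eq_succ_of_ne_zero hk.ne'
  rw [Nat.succ_eq_add_one] at *
  set e := (∑ j, (κ j - 1)) - m * n * (n - 1) with he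
  set α : Fin n →₀ ℕ := Finsupp.equivFunOnFinite.symm fun j => κ j - 1 with hα
  have hN : m * (n - 1) ≤ N := Nat.lt_succ_iff.1 hkm
  have hαj : ∀ j, α j = κ j - 1 := fun j => rfl
  have hκ1 : ∀ j, κ j = α j + 1 := fun j => by rw [hαj]; rcases hκ j with h | h <;> omega
  have hle : m * n * (n - 1) ≤ ∑ j, α j := by
    calc m * n * (n - 1) = ∑ _j : Fin n, m * (n - 1) := by simp; ring
      _ ≤ ∑ j, α j := sum_le_sum fun j _ => hN.trans (by
          rw [hαj]; rcases hκ j with h | h <;> omega)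
  have he' : m * n * (n - 1) + e = ∑ j, α j := by
    rw [he]; exact Nat.add_sub_cancel' hle
  have hexp : (∑ j, κ j) + m * n - (m * n ^ 2 + n) = e := by
    have h1 : ∑ j, κ j = ∑ j, α j + n := by simp [hκ1, sum_add_distrib]
    have h2 : m * n ^ 2 = m * n * (n - 1) + m * n := by
      rw [← Nat.mul_succ, Nat.succ_eq_add_one, Nat.sub_add_cancel hn]; ring
    omega
  set T : Finset (Fin n) := univ.filter fun j => κ j = N + 1 with hT
  have hTc : s = Tᶜ.card := by
    rw [hs]
    congr 1
    ext j
    simp only [hT, mem_filter, mem_univ, true_and, mem_compl]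
    rcases hκ j with h | h <;> omega
  have hαT : ∀ j, α j = if j ∈ T then N else N + 1 := fun j => by
    rw [hαj]
    simp only [hT, mem_filter, mem_univ, true_and]
    rcases hκ j with h | h <;> simp [h]
  -- The integer is the coefficient of the same polynomial over `ℤ`.
  refine ⟨coeff α (diffProd (Fin n) ℤ m * (∑ j, X j) ^ e), ?_, ?_⟩
  · have h := coeff_diffProd_mul_sum_X_pow (ι := Fin n) (m := m) (N := N) (e := e) (T := T) (α := α)
      (by simpa using hn) (by simpa using hN) hαT (by simpa using he')
    rw [← map_diffProd_mul_sum_X_pow, coeff_map, Fintype.card_fin, ← hTc] at h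
    rw [hexp]
    refine h.trans ?_
    congr 1
    rw [show Icc 1 n = Ico (0 + 1) (n + 1) by ext; simp, ← prod_Ico_add', ← range_eq_Ico]
    refine prod_congr rfl fun j _ => ?_
    rw [Nat.add_sub_cancel, Nat.succ_mul, Nat.add_sub_add_right]
  · change coeff α (diffProd (Fin n) F m * (∑ j, X j) ^ e) = _
    rw [← map_diffProd_mul_sum_X_pow, coeff_map]
    rfl
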